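/- Let $\mathcal E,\mathcal K$ be complex Hilbert spaces. Let $H^2_{\mathcal E}(\mathbb D)$ be the Hardy space of power series $f(z)=\sum_{n\ge 0}a_nz^n$ with $a_n\in\mathcal E$ and $\|f\|^2=\sum_n\|a_n\|^2<\infty$; for a bounded analytic $\Psi:\mathbb D\to\mathcal B(\mathcal E)$ let $T_\Psi=M_\Psi$ be the operator $(M_\Psi f)(z)=\Psi(z)f(z)$ on $H^2_{\mathcal E}(\mathbb D)$. A unitary part of a bounded operator $T$ on a Hilbert space is a nonzero closed subspace $\mathcal M$ that reduces $T$ (i.e. $T\mathcal M\subseteq\mathcal M$ and $T^*\mathcal M\subseteq\mathcal M$) and for which $T|_{\mathcal M}:\mathcal M\to\mathcal M$ is unitary. Let $$W=\begin{bmatrix}A&B\\ C&0\end{bmatrix}:\mathcal E\oplus\mathcal K\to\mathcal E\oplus\mathcal K$$ be unitary, let $\Phi(z)=A+zBC$ $(z\in\mathbb D)$ be its transfer function, and suppose that $M_\Phi$ has a unitary part $\mathcal M\subseteq H^2_{\mathcal E}(\mathbb D)$. If at least one of the following conditions holds, then the operator $\Phi(0)\in\mathcal B(\mathcal E)$ has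 a unitary part: (i) $\|T_{\Phi(0)}f\|=\|f\|$ for all $f\in\mathcal M$, where $T_{\Phi(0)}$ is the operator on $H^2_{\mathcal E}(\mathbb D)$ with constant symbol $\Phi(0)$; (ii) $\|T_{\Phi(0)}^*f\|=\|f\|$ for all $f\in\mathcal M$, and $\ker\Phi(0)\perp\mathcal M$, where $\ker\Phi(0)\subseteq\mathcal E$ is viewed as a space of constant functions in $H^2_{\mathcal E}(\mathbb D)$. -/

import Mathlib

open scoped ENNReal InnerProductSpace

/-- The Hardy space of the unit disc with values in `E`: power series `∑ aₙ zⁿ` with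
`∑ ‖aₙ‖² < ∞`, given by their coefficient sequences, with the norm `(∑ ‖aₙ‖²) ^ (1/2)`. -/
abbrev HardySpace (E : Type*) [NormedAddCommGroup E] : Type _ :=
  lp (fun _ : ℕ => E) 2

namespace HardySpace

variable {E : Type*} [NormedAddCommGroup E] [InnerProductSpace ℂ E]

/-- The value at `z` (used for `‖z‖ < 1`) of an element of the Hardy space. -/
noncomputable def eval (f : HardySpace E) (z : ℂ) : E := ∑' n : ℕ, z ^ n • f n

/-- The constant function with value `x`, as an element of the Hardy space. -/
noncomputable def const (x : E) : HardySpace E := lp.single 2 0 x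

/-- The power series of an element of the Hardy space converges on the open unit disc. -/
theorem hasSum_eval [CompleteSpace E] (f : HardySpace E) {z : ℂ} (hz : ‖z‖ < 1) :
    HasSum (fun n : ℕ => z ^ n • f n) (f.eval z) := by
  refine Summable.hasSum (Summable.of_norm_bounded (g := fun n : ℕ => ‖z‖ ^ n * ‖f‖)
    ((summable_geometric_of_lt_one (norm_nonneg z) hz).mul_right ‖f‖) ?_)
  intro n
  rw [norm_smul, norm_pow]
  exact mul_le_mul_of_nonneg_left (lp.norm_apply_le_norm (by norm_num) f n) (by positivity)

theorem eval_const (x : E) (z : ℂ) : (const x).eval z = x := by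
  unfold eval const
  rw [tsum_eq_single 0]
  · simp
  · intro n hn
    have h0 : lp.single (E := fun _ : ℕ => E) 2 0 x n = 0 :=
      lp.single_apply_ne (E := fun _ : ℕ => E) 2 0 x hn
    exact (congrArg (fun y => z ^ n • y) h0).trans (smul_zero _)

/-- An element of the Hardy space is determined by its values on the open unit disc. -/
theorem ext_eval [CompleteSpace E] {f g : HardySpace E}
    (h : ∀ z : ℂ, ‖z‖ < 1 → f.eval z = g.eval z) : f = g := by
  let p : HardySpace E → FormalMultilinearSeries ℂ ℂ E := fun f n =>
    ContinuousMultilinearMap.mkPiRing ℂ (Fin n) (f n)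
  have hp : ∀ f : HardySpace E, HasFPowerSeriesAt f.eval (p f) 0 := by
    intro f
    rw [hasFPowerSeriesAt_iff]
    filter_upwards [Metric.ball_mem_nhds (0 : ℂ) one_pos] with z hz
    have hz' : ‖z‖ < 1 := by simpa using hz
    simpa [p, FormalMultilinearSeries.coeff] using hasSum_eval f hz'
  have hev : ∀ᶠ z in nhds (0 : ℂ), f.eval z = g.eval z := by
    filter_upwards [Metric.ball_mem_nhds (0 : ℂ) one_pos] with z hz
    exact h z (by simpa using hz)
  have hpq := (hp f).eq_formalMultilinearSeries_of_eventually (hp g) hev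
  apply lp.ext
  funext n
  have h1 := congrArg (fun q : FormalMultilinearSeries ℂ ℂ E => q.coeff n) hpq
  simpa [p, FormalMultilinearSeries.coeff] using h1

/-- A bounded operator `T` on the Hardy space is multiplication by the operator-valued
function `Φ` on the open unit disc: `(T f)(z) = Φ(z) f(z)`. -/
def IsMulBy (Φ : ℂ → E →L[ℂ] E) (T : HardySpace E →L[ℂ] HardySpace E) : Prop :=
  ∀ (f : HardySpace E) (z : ℂ), ‖z‖ < 1 → (T f).eval z = Φ z (f.eval z)

theorem IsMulBy.unique [CompleteSpace E] {Φ : ℂ → E →L[ℂ] E}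
    {S T : HardySpace E →L[ℂ] HardySpace E} (hS : IsMulBy Φ S) (hT : IsMulBy Φ T) : S = T :=
  ContinuousLinearMap.ext fun f => ext_eval fun z hz => by rw [hS f z hz, hT f z hz]

open Classical in
/-- The analytic Toeplitz operator with symbol `Φ`: the bounded operator of multiplication
by `Φ` on the Hardy space (and `0` if there is none; see `isMulBy_toeplitz` for the symbols of
degree at most one). -/
noncomputable def toeplitz (Φ : ℂ → E →L[ℂ] E) : HardySpace E →L[ℂ] HardySpace E :=
  if h : ∃ T, IsMulBy Φ T then h.choose else 0

theorem IsMulBy.toeplitz_eq [CompleteSpace E] {Φ : ℂ → E →L[ℂ] E}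
    {T : HardySpace E →L[ℂ] HardySpace E} (hT : IsMulBy Φ T) : toeplitz Φ = T := by
  have h : ∃ T, IsMulBy Φ T := ⟨T, hT⟩
  have h2 : toeplitz Φ = h.choose := by
    unfold toeplitz
    exact dif_pos h
  rw [h2]
  exact h.choose_spec.unique hT

/-- Coefficientwise application of a bounded operator. -/
noncomputable def mapOp (A : E →L[ℂ] E) : HardySpace E →L[ℂ] HardySpace E :=
  lp.mapCLM 2 (fun _ : ℕ => A) (K := ‖A‖) (norm_nonneg A) (fun _ => le_rfl)

theorem mapOp_apply (A : E →L[ℂ] E) (f : HardySpace E) (n : ℕ) : mapOp A f n = A (f n) := rfl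

/-- The coefficients of `z f(z)`. -/
def shiftSeq {E : Type*} [NormedAddCommGroup E] (a : ℕ → E) : ℕ → E
  | 0 => 0
  | n + 1 => a n

theorem hasSum_shiftSeq {E : Type*} [NormedAddCommGroup E] (f : HardySpace E) :
    HasSum (fun n => ‖shiftSeq f n‖ ^ (2 : ℝ≥0∞).toReal) (‖f‖ ^ (2 : ℝ≥0∞).toReal) := by
  rw [hasSum_nat_add_iff' 1 |>.symm]
  simpa [shiftSeq] using lp.hasSum_norm (p := 2) (by norm_num) f

/-- Multiplication by the independent variable `z` on the Hardy space. -/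
noncomputable def shift : HardySpace E →L[ℂ] HardySpace E :=
  LinearMap.mkContinuous
    { toFun := fun f => ⟨shiftSeq f, memℓp_gen (hasSum_shiftSeq f).summable⟩
      map_add' := fun f g => by
        apply lp.ext
        funext n
        cases n with
        | zero => exact (add_zero (0 : E)).symm
        | succ n => rfl
      map_smul' := fun c f => by
        apply lp.ext
        funext n
        cases n with
        | zero => exact (smul_zero c).symm
        | succ n => rfl } 1 (fun f => by
    rw [one_mul]
    refine lp.norm_le_of_tsum_le (by norm_num) (norm_nonneg f) ?_
    exact (hasSum_shiftSeq f).tsum_eq.le)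

theorem shift_zero (f : HardySpace E) : shift f 0 = 0 := rfl

theorem shift_succ (f : HardySpace E) (n : ℕ) : shift f (n + 1) = f n := rfl

theorem eval_mapOp [CompleteSpace E] (A : E →L[ℂ] E) (f : HardySpace E) {z : ℂ} (hz : ‖z‖ < 1) :
    (mapOp A f).eval z = A (f.eval z) := by
  refine HasSum.unique (hasSum_eval _ hz) ?_
  simpa [mapOp_apply] using A.hasSum (hasSum_eval f hz)

theorem eval_shift [CompleteSpace E] (f : HardySpace E) {z : ℂ} (hz : ‖z‖ < 1) :
    (shift f).eval z = z • f.eval z := by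
  refine HasSum.unique (hasSum_eval _ hz) ?_
  rw [hasSum_nat_add_iff' 1 |>.symm]
  simpa [shift_zero, shift_succ, pow_succ', mul_smul] using (hasSum_eval f hz).const_smul z

/-- Symbols of degree at most one do give bounded multiplication operators. -/
theorem isMulBy_toeplitz [CompleteSpace E] {Φ : ℂ → E →L[ℂ] E} (A G : E →L[ℂ] E)
    (hΦ : ∀ z : ℂ, ‖z‖ < 1 → Φ z = A + z • G) : IsMulBy Φ (toeplitz Φ) := by
  have h : IsMulBy Φ (mapOp A + shift ∘L mapOp G) := by
    intro f z hz
    have hadd : ∀ f g : HardySpace E, (f + g).eval z = f.eval z + g.eval z := fun f g =>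
      HasSum.unique (hasSum_eval _ hz)
        (by simpa using (hasSum_eval f hz).add (hasSum_eval g hz))
    rw [add_apply, ContinuousLinearMap.comp_apply, hadd, eval_shift _ hz,
      eval_mapOp _ _ hz, eval_mapOp _ _ hz, hΦ z hz]
    rfl
  rw [h.toeplitz_eq]
  exact h

end HardySpace

/-- `M` is a unitary part of the bounded operator `T`: a nonzero closed subspace that reduces
`T` (is invariant under `T` and `T†`) and on which `T` restricts to a unitary operator, that is,
to an isometry of `M` onto `M`. -/
structure IsUnitaryPart {H : Type*} [NormedAddCommGroup H] [InnerProductSpace ℂ H]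
    [CompleteSpace H] (T : H →L[ℂ] H) (M : Submodule ℂ H) : Prop where
  ne_bot : M ≠ ⊥
  isClosed : IsClosed (M : Set H)
  map_mem : ∀ x ∈ M, T x ∈ M
  adjoint_mem : ∀ x ∈ M, ContinuousLinearMap.adjoint T x ∈ M
  norm_map : ∀ x ∈ M, ‖T x‖ = ‖x‖
  surj : ∀ y ∈ M, ∃ x ∈ M, T x = y

/-- `T` has a unitary part. -/
def HasUnitaryPart {H : Type*} [NormedAddCommGroup H] [InnerProductSpace ℂ H]
    [CompleteSpace H] (T : H →L[ℂ] H) : Prop :=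
  ∃ M : Submodule ℂ H, IsUnitaryPart T M

section Colligation

variable {E K : Type*} [NormedAddCommGroup E] [InnerProductSpace ℂ E]
  [NormedAddCommGroup K] [InnerProductSpace ℂ K]

/-- The operator on the Hilbert space direct sum `E ⊕ K` with block matrix `[A B; C D]`. -/
noncomputable def blockOp (A : E →L[ℂ] E) (B : K →L[ℂ] E) (C : E →L[ℂ] K) (D : K →L[ℂ] K) :
    WithLp 2 (E × K) →L[ℂ] WithLp 2 (E × K) :=
  (WithLp.prodContinuousLinearEquiv 2 ℂ E K).symm.toContinuousLinearMap ∘L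
    ((A.coprod B).prod (C.coprod D)) ∘L
      (WithLp.prodContinuousLinearEquiv 2 ℂ E K).toContinuousLinearMap

theorem blockOp_apply (A : E →L[ℂ] E) (B : K →L[ℂ] E) (C : E →L[ℂ] K) (D : K →L[ℂ] K)
    (x : E) (y : K) :
    blockOp A B C D (WithLp.toLp 2 (x, y)) = WithLp.toLp 2 (A x + B y, C x + D y) := rfl

/-- The transfer function `z ↦ A + z B (1 - z D)⁻¹ C` of the colligation `[A B; C D]`
(used for `‖z‖ < 1`). -/
noncomputable def transferFunction (A : E →L[ℂ] E) (B : K →L[ℂ] E) (C : E →L[ℂ] K)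
    (D : K →L[ℂ] K) (z : ℂ) : E →L[ℂ] E :=
  A + z • (B ∘L Ring.inverse (1 - z • D) ∘L C)

theorem transferFunction_zero (A : E →L[ℂ] E) (B : K →L[ℂ] E) (C : E →L[ℂ] K) (z : ℂ) :
    transferFunction A B C 0 z = A + z • (B ∘L C) := by
  unfold transferFunction
  rw [smul_zero, sub_zero, Ring.inverse_one]
  rfl

end Colligation

/-! Unitarity of `W` and of its adjoint gives `‖A x‖² + ‖C x‖² = ‖x‖²` and `‖A† x‖² + ‖B† x‖² =
‖x‖²`, where `A = Φ 0`. If the contraction `A` preserves the norm of every `f ∈ M`, it preserves the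
norm of each coefficient of `f`, so `C` kills these coefficients and `M_Φ` acts on `M` as `A` does,
coefficient by coefficient. The closed span of all coefficients of elements of `M` is then a unitary
part of `A` (`isUnitaryPart_coeffSpan`). In the second case the same argument runs for the adjoints,
with `B†` in place of `C`. -/

open ContinuousLinearMap in
theorem apply_adjoint_of_norm_map {H₁ H₂ : Type*} [NormedAddCommGroup H₁] [InnerProductSpace ℂ H₁]
    [CompleteSpace H₁] [NormedAddCommGroup H₂] [InnerProductSpace ℂ H₂] [CompleteSpace H₂]
    (V : H₁ →L[ℂ] H₂) (hV : ‖V‖ ≤ 1) {x : H₁} (hx : ‖V x‖ = ‖x‖) : adjoint V (V x) = x := by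
  have h1 : ‖adjoint V (V x)‖ ≤ ‖x‖ := by
    have := (adjoint V).le_of_opNorm_le (c := 1) (by simpa using hV) (V x)
    rwa [one_mul, hx] at this
  have h2 : RCLike.re ⟪adjoint V (V x), x⟫_ℂ = ‖x‖ ^ 2 := by
    rw [adjoint_inner_left, inner_self_eq_norm_sq (𝕜 := ℂ), hx]
  have h3 := norm_sub_sq (𝕜 := ℂ) (adjoint V (V x)) x
  rw [h2] at h3
  -- The square expands to `‖V†V x‖² - 2‖x‖² + ‖x‖²`, and `‖V†V x‖ ≤ ‖x‖`.
  have h4 : ‖adjoint V (V x) - x‖ ^ 2 ≤ 0 := by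
    have := pow_le_pow_left₀ (norm_nonneg _) h1 2
    linarith
  exact sub_eq_zero.mp (norm_eq_zero.mp (pow_eq_zero_iff two_ne_zero |>.mp
    (le_antisymm h4 (by positivity))))

namespace IsUnitaryPart

open ContinuousLinearMap

variable {H : Type*} [NormedAddCommGroup H] [InnerProductSpace ℂ H] [CompleteSpace H]
  {T : H →L[ℂ] H} {M : Submodule ℂ H}

/-- `T` need not be a contraction, so polarization on `M` is used: since `M` reduces `T`, the vector
`T†T x - x` lies in `M`, and it is orthogonal to `M`, hence to itself. -/
theorem adjoint_apply_apply (hM : IsUnitaryPart T M) {x : H} (hx : x ∈ M) :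
    adjoint T (T x) = x := by
  have hinner : ∀ y ∈ M, ⟪T x, T y⟫_ℂ = ⟪x, y⟫_ℂ := fun y hy => by
    let i : M →ₗᵢ[ℂ] H := ⟨(T : H →ₗ[ℂ] H) ∘ₗ M.subtype, fun z => hM.norm_map z z.2⟩
    exact i.inner_map_map ⟨x, hx⟩ ⟨y, hy⟩
  have hd : adjoint T (T x) - x ∈ M := M.sub_mem (hM.adjoint_mem _ (hM.map_mem _ hx)) hx
  rw [← sub_eq_zero, ← inner_self_eq_zero (𝕜 := ℂ)]
  conv_lhs => rw [inner_sub_left, adjoint_inner_left, hinner _ hd, sub_self]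

/-- A unitary part of an operator is one of its adjoint. -/
theorem adjoint (hM : IsUnitaryPart T M) : IsUnitaryPart (adjoint T) M where
  ne_bot := hM.ne_bot
  isClosed := hM.isClosed
  map_mem := hM.adjoint_mem
  adjoint_mem := by simpa using hM.map_mem
  norm_map y hy := by
    obtain ⟨x, hx, rfl⟩ := hM.surj y hy
    rw [hM.adjoint_apply_apply hx, hM.norm_map x hx]
  surj x hx := ⟨T x, hM.map_mem x hx, hM.adjoint_apply_apply hx⟩

end IsUnitaryPart

theorem HasUnitaryPart.of_adjoint {H : Type*} [NormedAddCommGroup H] [InnerProductSpace ℂ H]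
    [CompleteSpace H] {T : H →L[ℂ] H} (h : HasUnitaryPart (ContinuousLinearMap.adjoint T)) :
    HasUnitaryPart T := by
  obtain ⟨M, hM⟩ := h
  exact ⟨M, by simpa using hM.adjoint⟩

/-! ### Coefficientwise operators and the span of coefficients -/

namespace HardySpace

open ContinuousLinearMap

variable {E : Type*} [NormedAddCommGroup E] [InnerProductSpace ℂ E]

/-- The nonnegative terms `‖f n‖² - ‖V (f n)‖²` have sum zero, so each of them vanishes. -/
theorem norm_apply_of_norm_mapOp {V : E →L[ℂ] E} (hV : ‖V‖ ≤ 1) {f : HardySpace E}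
    (hf : ‖mapOp V f‖ = ‖f‖) (n : ℕ) : ‖V (f n)‖ = ‖f n‖ := by
  have hp : 0 < (2 : ℝ≥0∞).toReal := by norm_num
  have hle : ∀ x, ‖V x‖ ≤ ‖x‖ := fun x => by simpa using V.le_of_opNorm_le hV x
  have hsum := (lp.hasSum_norm hp f).sub (lp.hasSum_norm hp (mapOp V f))
  rw [hf, sub_self] at hsum
  have hz := (hasSum_zero_iff_of_nonneg (fun k => by
    simpa [mapOp_apply] using pow_le_pow_left₀ (norm_nonneg _) (hle (f k)) 2)).mp hsum
  have hn := congrFun hz n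
  simp only [mapOp_apply, ENNReal.toReal_ofNat, Real.rpow_ofNat, Pi.zero_apply] at hn
  exact ((pow_left_inj₀ (norm_nonneg _) (norm_nonneg _) two_ne_zero).mp (sub_eq_zero.mp hn)).symm

theorem toeplitz_eq [CompleteSpace E] {Φ : ℂ → E →L[ℂ] E} (A G : E →L[ℂ] E)
    (hΦ : ∀ z : ℂ, ‖z‖ < 1 → Φ z = A + z • G) : toeplitz Φ = mapOp A + shift ∘L mapOp G := by
  apply IsMulBy.toeplitz_eq
  intro f z hz
  have hadd : ∀ f g : HardySpace E, (f + g).eval z = f.eval z + g.eval z := fun f g =>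
    HasSum.unique (hasSum_eval _ hz)
      (by simpa using (hasSum_eval f hz).add (hasSum_eval g hz))
  rw [add_apply, ContinuousLinearMap.comp_apply, hadd, eval_shift _ hz,
    eval_mapOp _ _ hz, eval_mapOp _ _ hz, hΦ z hz]
  rfl

theorem toeplitz_const [CompleteSpace E] (A : E →L[ℂ] E) :
    toeplitz (fun _ => A) = mapOp A :=
  IsMulBy.toeplitz_eq fun f _ hz => eval_mapOp A f hz

theorem mapOp_single (A : E →L[ℂ] E) (n : ℕ) (x : E) :
    mapOp A (lp.single 2 n x) = lp.single 2 n (A x) := by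
  apply lp.ext
  funext m
  rw [mapOp_apply]
  by_cases hm : m = n
  · subst hm
    simp
  · simp [lp.single_apply, hm]

theorem shift_single (n : ℕ) (x : E) :
    shift (lp.single 2 n x : HardySpace E) = lp.single 2 (n + 1) x := by
  apply lp.ext
  funext m
  cases m with
  | zero => simp [shift_zero, lp.single_apply]
  | succ m => simp [shift_succ, lp.single_apply, Pi.single_apply]

theorem adjoint_mapOp_apply [CompleteSpace E] (A : E →L[ℂ] E) (f : HardySpace E) (n : ℕ) :
    adjoint (mapOp A) f n = adjoint A (f n) := by
  refine ext_inner_left ℂ fun x => ?_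
  rw [← lp.inner_single_left (𝕜 := ℂ) (G := fun _ : ℕ => E), adjoint_inner_right, mapOp_single,
    lp.inner_single_left, adjoint_inner_right]

theorem adjoint_shift_apply [CompleteSpace E] (f : HardySpace E) (n : ℕ) :
    adjoint shift f n = f (n + 1) := by
  refine ext_inner_left ℂ fun x => ?_
  rw [← lp.inner_single_left (𝕜 := ℂ) (G := fun _ : ℕ => E), adjoint_inner_right, shift_single,
    lp.inner_single_left]

theorem adjoint_mapOp [CompleteSpace E] (A : E →L[ℂ] E) :
    adjoint (mapOp A) = mapOp (adjoint A) := by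
  ext f n
  exact adjoint_mapOp_apply A f n

/-- The closed span of the coefficients of the elements of `M`. -/
noncomputable def coeffSpan (M : Submodule ℂ (HardySpace E)) : Submodule ℂ E :=
  (Submodule.span ℂ {x | ∃ f ∈ M, ∃ n, f n = x}).topologicalClosure

theorem coeffSpan_le {M : Submodule ℂ (HardySpace E)} {N : Submodule ℂ E}
    (hN : IsClosed (N : Set E)) (h : ∀ f ∈ M, ∀ n, f n ∈ N) : coeffSpan M ≤ N := by
  refine Submodule.topologicalClosure_minimal _ (Submodule.span_le.mpr ?_) hN
  rintro _ ⟨f, hf, n, rfl⟩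
  exact h f hf n

theorem apply_mem_coeffSpan {M : Submodule ℂ (HardySpace E)} {f : HardySpace E} (hf : f ∈ M)
    (n : ℕ) : f n ∈ coeffSpan M :=
  Submodule.le_topologicalClosure _ (Submodule.subset_span ⟨f, hf, n, rfl⟩)

theorem isClosed_coeffSpan (M : Submodule ℂ (HardySpace E)) :
    IsClosed (coeffSpan M : Set E) :=
  Submodule.isClosed_topologicalClosure _

/-- If an operator acts on its unitary part `M` by applying `V` to the coefficients, and `V` is
isometric on the coefficients of elements of `M`, then these span a unitary part of `V`. -/
theorem isUnitaryPart_coeffSpan [CompleteSpace E] {R : HardySpace E →L[ℂ] HardySpace E}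
    {M : Submodule ℂ (HardySpace E)} (hM : IsUnitaryPart R M) {V : E →L[ℂ] E}
    (hR : ∀ f ∈ M, ∀ n, R f n = V (f n))
    (hV : ∀ f ∈ M, ∀ n, adjoint V (V (f n)) = f n) : IsUnitaryPart V (coeffSpan M) := by
  have hcl := isClosed_coeffSpan M
  have hmap : coeffSpan M ≤ (coeffSpan M).comap (V : E →ₗ[ℂ] E) :=
    coeffSpan_le (hcl.preimage V.continuous) fun f hf n => by
      change V (f n) ∈ coeffSpan M
      rw [← hR f hf]
      exact apply_mem_coeffSpan (hM.map_mem f hf) n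
  have hadj : coeffSpan M ≤ (coeffSpan M).comap (adjoint V : E →ₗ[ℂ] E) :=
    -- Writing `g = R f` with `f ∈ M` gives `V† (g n) = V†V (f n) = f n`, again a coefficient.
    coeffSpan_le (hcl.preimage (adjoint V).continuous) fun g hg n => by
      obtain ⟨f, hf, rfl⟩ := hM.surj g hg
      change adjoint V (R f n) ∈ coeffSpan M
      rw [hR f hf, hV f hf]
      exact apply_mem_coeffSpan hf n
  -- `V†V x = x` and `V V† x = x` each cut out a closed subspace, so it is enough to check them on
  -- coefficients.
  have hleft : coeffSpan M ≤ LinearMap.eqLocus (adjoint V ∘L V : E →ₗ[ℂ] E) LinearMap.id :=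
    coeffSpan_le (isClosed_eq (adjoint V ∘L V).continuous continuous_id) hV
  have hright : coeffSpan M ≤ LinearMap.eqLocus (V ∘L adjoint V : E →ₗ[ℂ] E) LinearMap.id :=
    coeffSpan_le (isClosed_eq (V ∘L adjoint V).continuous continuous_id) fun g hg n => by
      obtain ⟨f, hf, rfl⟩ := hM.surj g hg
      change V (adjoint V (R f n)) = R f n
      rw [hR f hf, hV f hf]
  refine ⟨fun hbot => hM.ne_bot ?_, hcl, hmap, hadj, fun x hx => ?_,
    fun y hy => ⟨adjoint V y, hadj hy, hright hy⟩⟩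
  · rw [Submodule.eq_bot_iff]
    intro f hf
    apply lp.ext
    funext n
    have := apply_mem_coeffSpan hf n
    rwa [hbot, Submodule.mem_bot] at this
  · have hx' : adjoint V (V x) = x := hleft hx
    have h2 : ‖V x‖ ^ 2 = ‖x‖ ^ 2 := by
      rw [← inner_self_eq_norm_sq (𝕜 := ℂ), ← inner_self_eq_norm_sq (𝕜 := ℂ),
        ← adjoint_inner_left, hx']
    exact (pow_left_inj₀ (norm_nonneg _) (norm_nonneg _) two_ne_zero).mp h2

end HardySpace

/-! ### Norm identities from a unitary block operator -/

section UnitaryColligation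

open ContinuousLinearMap

variable {E K : Type*} [NormedAddCommGroup E] [InnerProductSpace ℂ E]
  [NormedAddCommGroup K] [InnerProductSpace ℂ K]

theorem norm_le_one_of_norm_sq {A : E →L[ℂ] E} {C : E →L[ℂ] K}
    (h : ∀ x, ‖A x‖ ^ 2 + ‖C x‖ ^ 2 = ‖x‖ ^ 2) : ‖A‖ ≤ 1 :=
  opNorm_le_bound _ zero_le_one fun x => by
    rw [one_mul]
    have := h x
    exact (pow_le_pow_iff_left₀ (norm_nonneg _) (norm_nonneg _) two_ne_zero).mp
      (by nlinarith [sq_nonneg ‖C x‖])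

theorem apply_eq_zero_of_norm_sq {A : E →L[ℂ] E} {C : E →L[ℂ] K}
    (h : ∀ x, ‖A x‖ ^ 2 + ‖C x‖ ^ 2 = ‖x‖ ^ 2) {x : E} (hx : ‖A x‖ = ‖x‖) : C x = 0 := by
  have := h x
  rw [hx] at this
  simpa using this

variable [CompleteSpace E] [CompleteSpace K]

theorem adjoint_blockOp (A : E →L[ℂ] E) (B : K →L[ℂ] E) (C : E →L[ℂ] K) (D : K →L[ℂ] K) :
    adjoint (blockOp A B C D) = blockOp (adjoint A) (adjoint C) (adjoint B) (adjoint D) := by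
  refine ((eq_adjoint_iff _ _).mpr fun u v => ?_).symm
  obtain ⟨x, y⟩ := u
  obtain ⟨x', y'⟩ := v
  simp only [blockOp_apply, WithLp.prod_inner_apply, inner_add_left, inner_add_right,
    adjoint_inner_left]
  ring

theorem norm_sq_of_blockOp_mem_unitary {A : E →L[ℂ] E} {B : K →L[ℂ] E} {C : E →L[ℂ] K}
    {D : K →L[ℂ] K}
    (hW : blockOp A B C D ∈ unitary (WithLp 2 (E × K) →L[ℂ] WithLp 2 (E × K))) (x : E) :
    ‖A x‖ ^ 2 + ‖C x‖ ^ 2 = ‖x‖ ^ 2 := by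
  have h := norm_map_of_mem_unitary hW (WithLp.toLp 2 (x, (0 : K)))
  rw [blockOp_apply] at h
  have h2 := congrArg (· ^ 2) h
  simpa [WithLp.prod_norm_sq_eq_of_L2] using h2

end UnitaryColligation

theorem theorem4p5 {E K : Type*} [NormedAddCommGroup E] [InnerProductSpace ℂ E] [CompleteSpace E]
    [NormedAddCommGroup K] [InnerProductSpace ℂ K] [CompleteSpace K]
    (A : E →L[ℂ] E) (B : K →L[ℂ] E) (C : E →L[ℂ] K)
    (hW : blockOp A B C 0 ∈ unitary (WithLp 2 (E × K) →L[ℂ] WithLp 2 (E × K)))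
    (Φ : ℂ → E →L[ℂ] E) (hΦ : ∀ z : ℂ, ‖z‖ < 1 → Φ z = transferFunction A B C 0 z)
    (M : Submodule ℂ (HardySpace E)) (hM : IsUnitaryPart (HardySpace.toeplitz Φ) M)
    (h : (∀ f ∈ M, ‖HardySpace.toeplitz (fun _ => Φ 0) f‖ = ‖f‖) ∨
      ((∀ f ∈ M,
          ‖ContinuousLinearMap.adjoint (HardySpace.toeplitz (fun _ => Φ 0)) f‖ = ‖f‖) ∧
        ∀ η : E, Φ 0 η = 0 → ∀ f ∈ M, ⟪HardySpace.const η, f⟫_ℂ = 0)) :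
    HasUnitaryPart (Φ 0) := by 
  have hG : ∀ z : ℂ, ‖z‖ < 1 → Φ z = A + z • (B ∘L C) := fun z hz => by
    rw [hΦ z hz, transferFunction_zero]
  have hA : Φ 0 = A := by simpa using hG 0 (by simp)
  have hW' := Unitary.star_mem hW
  rw [ContinuousLinearMap.star_eq_adjoint, adjoint_blockOp] at hW'
  have hAC := norm_sq_of_blockOp_mem_unitary hW
  have hAB := norm_sq_of_blockOp_mem_unitary hW'
  rw [HardySpace.toeplitz_eq A (B ∘L C) hG] at hM
  rw [hA, HardySpace.toeplitz_const, HardySpace.adjoint_mapOp] at h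
  rw [hA]
  rcases h with h | ⟨h, -⟩
  · have hn := norm_le_one_of_norm_sq hAC
    have hiso := fun f hf => HardySpace.norm_apply_of_norm_mapOp hn (h f hf)
    refine ⟨_, HardySpace.isUnitaryPart_coeffSpan hM (fun f hf n => ?_)
      (fun f hf n => apply_adjoint_of_norm_map A hn (hiso f hf n))⟩
    -- Equality in `‖A x‖² + ‖C x‖² = ‖x‖²` forces `C (f n) = 0`, so the degree-one term of the
    -- symbol contributes nothing on `M`.
    have hs : HardySpace.shift (HardySpace.mapOp (B ∘L C) f) = 0 := by
      apply lp.ext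
      funext n
      cases n with
      | zero => rfl
      | succ n =>
        rw [HardySpace.shift_succ, HardySpace.mapOp_apply, ContinuousLinearMap.comp_apply,
          apply_eq_zero_of_norm_sq hAC (hiso f hf n), map_zero]
        rfl
    rw [add_apply, ContinuousLinearMap.comp_apply, hs, add_zero, HardySpace.mapOp_apply]
  · have hn := norm_le_one_of_norm_sq hAB
    have hiso := fun f hf => HardySpace.norm_apply_of_norm_mapOp hn (h f hf)
    refine HasUnitaryPart.of_adjoint ⟨_, HardySpace.isUnitaryPart_coeffSpan hM.adjoint
      (fun f hf n => ?_) (fun f hf n => apply_adjoint_of_norm_map _ hn (hiso f hf n))⟩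
    -- The adjoint of the shift moves coefficients back: the `n`-th coefficient of `M_Φ† f` is `A†
    -- (f n) + C† B† (f (n + 1))`, and `B†` kills `f (n + 1)`.
    rw [map_add, ContinuousLinearMap.adjoint_comp, HardySpace.adjoint_mapOp,
      HardySpace.adjoint_mapOp, add_apply, ContinuousLinearMap.comp_apply, lp.coeFn_add,
      Pi.add_apply, HardySpace.mapOp_apply, HardySpace.mapOp_apply,
      HardySpace.adjoint_shift_apply, ContinuousLinearMap.adjoint_comp,
      ContinuousLinearMap.comp_apply, apply_eq_zero_of_norm_sq hAB (hiso f hf (n + 1)),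
      map_zero, add_zero]
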